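/- Let $\mathbb D=\{|z|<1\}$, $\mathbb T=\partial\mathbb D$ and $RH=\{w\in\mathbb C:\operatorname{Re}w>0\}$. Let $S:RH\to RH$ be holomorphic, let $\alpha$ be a Borel probability measure on $\mathbb T$, and let $\{M_t\}_{t\ge0}$ be a family of holomorphic maps $M_t:\mathbb D\to RH$ that solves the Burgers–Loewner equation $$\frac{\partial}{\partial t}M_t(z)=-z\,S(M_t(z))\,\frac{\partial}{\partial z}M_t(z)\quad(t\ge0,\ z\in\mathbb D),\qquad M_0(z)=\int_{\mathbb T}\frac{x+z}{x-z}\,\alpha(dx),$$ where the time derivative at $t=0$ is one-sided. A *decreasing normalized Loewner chain* is a family $\{g_t\}_{t\ge0}$ of univalent holomorphic functions on $\mathbb D$ with $g_t(0)=0$, $g_0(z)=z$, $g_t(\mathbb D)\subset g_s(\mathbb D)$ for $0\le s\le t$, and $g_t'(0)=e^{-ta}$ for all $t\ge0$, for some $a\in RH$ independent of $t$. A *decreasing normalized subordination chain* is a family $\{f_t\}_{t\ge0}$ of holomorphic functions on $\mathbb D$ with a common value at $0$ such that $f_t=f_0\circ g_t$ for all $t\ge0$, for some decreasing normalized Loewner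 chain $\{g_t\}_{t\ge0}$. Then for every $t\ge0$ there is exactly one Borel probability measure $\mu_t$ on $\mathbb T$ with $M_t(z)=\int_{\mathbb T}\frac{x+z}{x-z}\,\mu_t(dx)$ for all $z\in\mathbb D$, and the following hold. (a) $\{M_t\}_{t\ge0}$ is a decreasing normalized subordination chain. (b) There is $T>0$ such that for all $t\ge T$: $\operatorname{supp}\mu_t=\mathbb T$; $M_t$ extends analytically to (a neighbourhood of) $\overline{\mathbb D}$ and the extension satisfies $\operatorname{Re}M_t(x)>0$ for all $x\in\mathbb T$; and $\mu_t$ is absolutely continuous with respect to the uniform distribution on $\mathbb T$. (c) As $t\to\infty$, $M_t\to1$ locally uniformly on $\mathbb D$ and (equivalently) $\mu_t$ converges weakly to the uniform distribution on $\mathbb T$. -/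

import Mathlib

open Set Filter Topology MeasureTheory

noncomputable section

namespace BurgersLoewner

/-- The open unit disc of the complex plane. -/
abbrev disc : Set ℂ := Metric.ball (0 : ℂ) 1

/-- The open right half-plane. -/
abbrev rightHalfPlane : Set ℂ := {w : ℂ | 0 < w.re}

/-- The unit circle carries its Borel sigma-algebra. -/
instance instMeasurableSpaceCircle : MeasurableSpace Circle := borel Circle

instance instBorelSpaceCircle : BorelSpace Circle := ⟨rfl⟩

/-- The Herglotz function of a probability measure on the unit circle,
`z ↦ ∫ (x + z) / (x - z) μ(dx)`, to be used for `z` in the open unit disc. -/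
def herglotz (μ : ProbabilityMeasure Circle) (z : ℂ) : ℂ :=
  ∫ x : Circle, ((x : ℂ) + z) / ((x : ℂ) - z) ∂(μ : Measure Circle)

/-- Normalized Lebesgue measure on `(0, 2π]`, transported to the circle by `θ ↦ exp (i θ)`. -/
def uniformMeasure : Measure Circle :=
  Measure.map (fun θ : ℝ => Circle.exp θ)
    ((ENNReal.ofReal (2 * Real.pi))⁻¹ • volume.restrict (Ioc 0 (2 * Real.pi)))

instance instIsProbabilityMeasureUniform : IsProbabilityMeasure uniformMeasure := by
  constructor
  have hm : Measurable (fun θ : ℝ => Circle.exp θ) := Circle.exp.continuous.measurable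
  have hpos : 0 < 2 * Real.pi := by positivity
  rw [uniformMeasure, Measure.map_apply hm MeasurableSet.univ]
  simp only [preimage_univ, Measure.smul_apply, Measure.restrict_apply_univ, Real.volume_Ioc,
    sub_zero, smul_eq_mul]
  exact ENNReal.inv_mul_cancel (by simpa using hpos) ENNReal.ofReal_ne_top

/-- The uniform distribution on the unit circle. -/
def uniformDistribution : ProbabilityMeasure Circle := ⟨uniformMeasure, inferInstance⟩

/-- A decreasing and normalized Loewner chain `(g t)`, `t ≥ 0`: univalent functions on the unit
disc fixing `0`, with decreasing images, starting at the identity, and with derivative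
`exp (-t a)` at `0` for one number `a` of positive real part that does not depend on `t`. -/
structure IsDecreasingLoewnerChain (g : ℝ → ℂ → ℂ) : Prop where
  differentiableOn : ∀ t, 0 ≤ t → DifferentiableOn ℂ (g t) disc
  injOn : ∀ t, 0 ≤ t → InjOn (g t) disc
  map_zero : ∀ t, 0 ≤ t → g t 0 = 0
  image_subset : ∀ s t, 0 ≤ s → s ≤ t → g t '' disc ⊆ g s '' disc
  initial : ∀ z ∈ disc, g 0 z = z
  deriv_zero : ∃ a : ℂ, 0 < a.re ∧ ∀ t : ℝ, 0 ≤ t → deriv (g t) 0 = Complex.exp (-(t : ℂ) * a)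

/-- A decreasing and normalized subordination chain `(f t)`, `t ≥ 0`: holomorphic functions on the
unit disc with a common value at `0`, such that `f t = f 0 ∘ g t` on the disc for a decreasing and
normalized Loewner chain `(g t)`. -/
structure IsDecreasingSubordinationChain (f : ℝ → ℂ → ℂ) : Prop where
  differentiableOn : ∀ t, 0 ≤ t → DifferentiableOn ℂ (f t) disc
  map_zero : ∀ t, 0 ≤ t → f t 0 = f 0 0
  exists_chain : ∃ g : ℝ → ℂ → ℂ, IsDecreasingLoewnerChain g ∧
    ∀ t, 0 ≤ t → ∀ z ∈ disc, f t z = f 0 (g t z)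

/-- `(M t)`, `t ≥ 0`, is a family of holomorphic maps from the unit disc to the right half-plane
that solves `∂M_t(z)/∂t = -z S(M_t(z)) ∂M_t(z)/∂z` for all `t ≥ 0` (one-sided time derivative at
`t = 0`) and all `z` in the disc, with initial value the Herglotz function of `α`. -/
structure IsSolution (S : ℂ → ℂ) (α : ProbabilityMeasure Circle) (M : ℝ → ℂ → ℂ) : Prop where
  differentiableOn : ∀ t, 0 ≤ t → DifferentiableOn ℂ (M t) disc
  mapsTo : ∀ t, 0 ≤ t → MapsTo (M t) disc rightHalfPlane
  initial : ∀ z ∈ disc, M 0 z = herglotz α z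
  hasDerivWithinAt : ∀ t, 0 ≤ t → ∀ z ∈ disc,
    HasDerivWithinAt (fun s : ℝ => M s z) (-z * S (M t z) * deriv (M t) z) (Ici 0) t

end BurgersLoewner

end

/-! The equation is quasilinear of first order, so it is solved by characteristics: `M (t - u) (z *
exp (-u * S (M t z))) = M t z` for `0 ≤ u ≤ t` (`IsSolution.apply_characteristic`). Run backwards in
time, a characteristic moves towards the origin because `Re S > 0`, so it never leaves the disc, and
a Grönwall argument shows that the solution is constant along it.

Taking `u = t` gives `M t = M 0 ∘ g t` with `g t z = z * exp (-t * S (M t z))`. The value `M t z` is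
thus a function of `g t z`, which makes `g t` injective; intermediate `u` give the nesting of the
images, and `M t 0 = 1` gives the derivative `exp (-t * S 1)` at `0`.

With `Q = S ∘ M 0`, the point `ζ = g t w` solves `ζ = w * exp (-t * Q ζ)`. For large `t` the right
side is a contraction of `‖ζ‖ ≤ 1/2` for every `‖w‖ < 2`, and its fixed point is holomorphic in `w`
and uniformly small (`exists_differentiableOn_fixedPoint`). Hence `M t` extends to the disc of
radius 2, keeps positive real part there, and tends uniformly to `M 0 0 = 1`
(`IsSolution.exists_extension`). By the Schwarz formula the measure then has density `Re M t` on the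
circle, positive and uniformly close to `1`, which yields (b) and (c).

The Herglotz representation comes from dilation and weak compactness (`exists_herglotz`), its
uniqueness from Fourier coefficients (`herglotz_injective`). -/

noncomputable section

namespace BurgersLoewner

/-! ### Differentiating a family of holomorphic functions along a moving point -/

section Calculus

/-- Second order Taylor bound for a bounded holomorphic function on a disc. -/
theorem norm_sub_sub_deriv_mul_le {f : ℂ → ℂ} {c w : ℂ} {R B : ℝ}
    (hd : DifferentiableOn ℂ f (Metric.ball c R)) (hB : ∀ z ∈ Metric.ball c R, ‖f z‖ ≤ B)
    (hw : w ∈ Metric.ball c R) :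
    ‖f w - f c - deriv f c * (w - c)‖ ≤ 4 * B * (‖w - c‖ / R) ^ 2 := by
  have hR : 0 < R := Metric.pos_of_mem_ball hw
  have hc : c ∈ Metric.ball c R := Metric.mem_ball_self hR
  have hfB : ∀ z ∈ Metric.ball c R, ‖f z - f c‖ ≤ 2 * B := fun z hz =>
    (norm_sub_le _ _).trans (by linarith [hB z hz, hB c hc])
  have hderiv : ‖deriv f c‖ ≤ 2 * B / R :=
    Complex.norm_deriv_le_div_of_mapsTo_ball hd
      (fun z hz => by simpa [dist_eq_norm] using hfB z hz) hR
  have hfc : HasDerivAt f (deriv f c) c :=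
    (hd.differentiableAt (Metric.isOpen_ball.mem_nhds hc)).hasDerivAt
  -- Removing the linear part leaves a function that agrees with its value at `c` to second order
  -- and stays within `2B + 2B` of it, so the higher-order Schwarz lemma applies.
  let h : ℂ → ℂ := fun z => f z - deriv f c * (z - c)
  have hh : DifferentiableOn ℂ h (Metric.ball c R) := by
    apply hd.sub
    fun_prop
  have hhc : h c = f c := by simp [h]
  have hmaps : MapsTo h (Metric.ball c R) (Metric.closedBall (h c) (4 * B)) := by
    intro z hz
    rw [mem_closedBall_iff_norm, hhc]
    have hzR : ‖z - c‖ ≤ R := (mem_ball_iff_norm.1 hz).le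
    have h1 : ‖deriv f c * (z - c)‖ ≤ 2 * B := by
      rw [norm_mul]
      calc ‖deriv f c‖ * ‖z - c‖ ≤ 2 * B / R * R := by
            apply mul_le_mul hderiv hzR (norm_nonneg _) ((norm_nonneg _).trans hderiv)
        _ = 2 * B := by field_simp
    calc ‖h z - f c‖ = ‖(f z - f c) - deriv f c * (z - c)‖ := by simp only [h]; ring_nf
      _ ≤ 4 * B := (norm_sub_le _ _).trans (by linarith [hfB z hz])
  have hlit : (h · - h c) =o[𝓝 c] (fun z => ‖z - c‖ ^ 1) := by
    have := hfc.isLittleO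
    simp only [pow_one]
    refine Asymptotics.IsLittleO.norm_right ?_
    refine this.congr_left fun z => ?_
    simp only [h, smul_eq_mul]
    ring
  have := Complex.dist_le_mul_div_pow_of_mapsTo_ball_of_isLittleO (n := 1) hh hmaps hlit hw
  rw [dist_eq_norm, dist_eq_norm, hhc] at this
  refine le_trans (le_of_eq ?_) this
  simp only [h]
  ring_nf

variable {f : ℝ → ℂ → ℂ} {A : Set ℝ} {s₀ : ℝ} {c : ℂ} {R B : ℝ}

/-- Pointwise continuity in the parameter of a bounded family of holomorphic functions implies
continuity of the derivatives in the parameter. -/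
theorem tendsto_deriv_of_bounded (hR : 0 < R)
    (hd : ∀ s ∈ A, DifferentiableOn ℂ (f s) (Metric.ball c R))
    (hB : ∀ s ∈ A, ∀ z ∈ Metric.ball c R, ‖f s z‖ ≤ B) (hs₀ : s₀ ∈ A)
    (hcont : ∀ z ∈ Metric.ball c R, ContinuousWithinAt (fun s => f s z) A s₀) :
    Tendsto (fun s => deriv (f s) c) (𝓝[A] s₀) (𝓝 (deriv (f s₀) c)) := by
  have hc : c ∈ Metric.ball c R := Metric.mem_ball_self hR
  have hB0 : 0 ≤ B := (norm_nonneg _).trans (hB s₀ hs₀ c hc)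
  rw [Metric.tendsto_nhds]
  intro ε hε
  -- The derivatives are compared through difference quotients with step `r`; the two Taylor errors,
  -- divided by `r`, sum to `8 * B / R ^ 2 * r`.
  obtain ⟨r, hr, hrR, hrε⟩ : ∃ r : ℝ, 0 < r ∧ r < R ∧ 8 * B / R ^ 2 * r < ε / 2 := by
    have h1 : Tendsto (fun r : ℝ => 8 * B / R ^ 2 * r) (𝓝[>] 0) (𝓝 0) := by
      have : Tendsto (fun r : ℝ => 8 * B / R ^ 2 * r) (𝓝 0) (𝓝 (8 * B / R ^ 2 * 0)) :=
        (continuous_const.mul continuous_id).tendsto 0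
      rw [mul_zero] at this
      exact this.mono_left nhdsWithin_le_nhds
    have h2 : ∀ᶠ r : ℝ in 𝓝[>] 0, r < R := nhdsWithin_le_nhds (gt_mem_nhds hR)
    obtain ⟨r, h3, h4, h5⟩ :=
      ((h1.eventually (gt_mem_nhds (half_pos hε))).and (h2.and self_mem_nhdsWithin)).exists
    exact ⟨r, h5, h4, h3⟩
  have hcr : c + r ∈ Metric.ball c R := by simpa [abs_of_pos hr] using hrR
  have hlim : Tendsto (fun s => ‖f s (c + r) - f s₀ (c + r)‖ + ‖f s c - f s₀ c‖)
      (𝓝[A] s₀) (𝓝 0) := by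
    have h1 := (tendsto_iff_norm_sub_tendsto_zero.1 (hcont _ hcr)).add
      (tendsto_iff_norm_sub_tendsto_zero.1 (hcont _ hc))
    simpa using h1
  filter_upwards [hlim.eventually (gt_mem_nhds (show 0 < r * (ε / 2) by positivity)),
    self_mem_nhdsWithin] with s hs hsA
  have h1 := norm_sub_sub_deriv_mul_le (hd s hsA) (hB s hsA) hcr
  have h2 := norm_sub_sub_deriv_mul_le (hd s₀ hs₀) (hB s₀ hs₀) hcr
  have hnr : ‖(r : ℂ)‖ = r := by simp [abs_of_pos hr]
  rw [add_sub_cancel_left] at h1 h2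
  rw [hnr] at h1 h2
  have key : (deriv (f s) c - deriv (f s₀) c) * r
      = -(f s (c + r) - f s c - deriv (f s) c * r)
        + (f s₀ (c + r) - f s₀ c - deriv (f s₀) c * r)
        + ((f s (c + r) - f s₀ (c + r)) - (f s c - f s₀ c)) := by ring
  have h3 : ‖deriv (f s) c - deriv (f s₀) c‖ * r ≤
      8 * B * (r / R) ^ 2 + (‖f s (c + r) - f s₀ (c + r)‖ + ‖f s c - f s₀ c‖) := by
    calc ‖deriv (f s) c - deriv (f s₀) c‖ * r
        = ‖(deriv (f s) c - deriv (f s₀) c) * r‖ := by rw [norm_mul, hnr]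
      _ ≤ _ := by
        rw [key]
        refine (norm_add_le _ _).trans ?_
        have h4 := norm_add_le (-(f s (c + r) - f s c - deriv (f s) c * r))
          (f s₀ (c + r) - f s₀ c - deriv (f s₀) c * r)
        rw [norm_neg] at h4
        have h5 := norm_sub_le (f s (c + r) - f s₀ (c + r)) (f s c - f s₀ c)
        linarith
  rw [dist_eq_norm]
  have h6 : 8 * B * (r / R) ^ 2 = 8 * B / R ^ 2 * r * r := by field_simp
  rw [h6] at h3
  have h7 : 8 * B / R ^ 2 * r * r < ε / 2 * r := mul_lt_mul_of_pos_right hrε hr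
  refine lt_of_mul_lt_mul_right (a := r) ?_ hr.le
  linarith

/-- Total derivative of `s ↦ f s (w s)` for a bounded family of holomorphic functions `f s`. -/
theorem hasDerivWithinAt_apply_curve {w : ℝ → ℂ} {w' d : ℂ} (hR : 0 < R)
    (hd : ∀ s ∈ A, DifferentiableOn ℂ (f s) (Metric.ball (w s₀) R))
    (hB : ∀ s ∈ A, ∀ z ∈ Metric.ball (w s₀) R, ‖f s z‖ ≤ B) (hs₀ : s₀ ∈ A)
    (hcont : ∀ z ∈ Metric.ball (w s₀) R, ContinuousWithinAt (fun s => f s z) A s₀)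
    (hf : HasDerivWithinAt (fun s => f s (w s₀)) d A s₀) (hw : HasDerivWithinAt w w' A s₀) :
    HasDerivWithinAt (fun s => f s (w s)) (d + deriv (f s₀) (w s₀) * w') A s₀ := by
  have hwO : (fun s => w s - w s₀) =O[𝓝[A] s₀] fun s => s - s₀ := hw.hasFDerivWithinAt.isBigO_sub
  have hw0 : Tendsto (fun s => w s - w s₀) (𝓝[A] s₀) (𝓝 0) := by
    simpa using hw.continuousWithinAt.tendsto.sub_const (w s₀)
  have hball : ∀ᶠ s in 𝓝[A] s₀, w s ∈ Metric.ball (w s₀) R :=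
    hw.continuousWithinAt (Metric.ball_mem_nhds _ hR)
  -- The increment splits into a Taylor remainder, the variation of the derivative in `s` times `w s
  -- - w s₀`, a linear term, and the increment at the fixed point `w s₀`. The first two are `o(s -
  -- s₀)`.
  have h1 : HasDerivWithinAt
      (fun s => f s (w s) - f s (w s₀) - deriv (f s) (w s₀) * (w s - w s₀)) 0 A s₀ := by
    rw [hasDerivWithinAt_iff_isLittleO]
    simp only [sub_self, mul_zero, smul_zero, sub_zero]
    have hb : (fun s => f s (w s) - f s (w s₀) - deriv (f s) (w s₀) * (w s - w s₀))
        =O[𝓝[A] s₀] fun s => (w s - w s₀) * (w s - w s₀) := by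
      refine Asymptotics.IsBigO.of_bound (4 * B / R ^ 2) ?_
      filter_upwards [hball, self_mem_nhdsWithin] with s hs hsA
      refine (norm_sub_sub_deriv_mul_le (hd s hsA) (hB s hsA) hs).trans (le_of_eq ?_)
      rw [norm_mul]
      ring
    refine hb.trans_isLittleO ?_
    have := ((Asymptotics.isLittleO_one_iff ℝ).2 hw0).mul_isBigO hwO
    simpa using this
  have h2 : HasDerivWithinAt
      (fun s => (deriv (f s) (w s₀) - deriv (f s₀) (w s₀)) * (w s - w s₀)) 0 A s₀ := by
    rw [hasDerivWithinAt_iff_isLittleO]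
    simp only [sub_self, mul_zero, smul_zero, sub_zero]
    have h0 : Tendsto (fun s => deriv (f s) (w s₀) - deriv (f s₀) (w s₀)) (𝓝[A] s₀) (𝓝 0) := by
      simpa using (tendsto_deriv_of_bounded hR hd hB hs₀ hcont).sub_const (deriv (f s₀) (w s₀))
    have := ((Asymptotics.isLittleO_one_iff ℝ).2 h0).mul_isBigO hwO
    simpa using this
  have h3 : HasDerivWithinAt (fun s => deriv (f s₀) (w s₀) * (w s - w s₀))
      (deriv (f s₀) (w s₀) * w') A s₀ := (hw.sub_const _).const_mul _
  refine ((((h1.add h2).add h3).add hf).congr (fun s _ => ?_) ?_).congr_deriv ?_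
  · simp only [Pi.add_apply]
    ring
  · simp only [Pi.add_apply]
    ring
  · ring

end Calculus

/-! ### Characteristics for disc-valued solutions -/

section Transport

variable {V : ℂ → ℂ} {N : ℝ → ℂ → ℂ}

theorem norm_mul_exp_neg_le {z v : ℂ} {u : ℝ} (hu : 0 ≤ u) (hv : 0 ≤ v.re) :
    ‖z * Complex.exp (-(u : ℂ) * v)‖ ≤ ‖z‖ := by
  rw [norm_mul, Complex.norm_exp]
  have : (-(u : ℂ) * v).re ≤ 0 := by
    simp only [neg_mul, Complex.neg_re, Complex.mul_re, Complex.ofReal_re, Complex.ofReal_im,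
      zero_mul, sub_zero]
    nlinarith
  exact mul_le_of_le_one_right (norm_nonneg _) (Real.exp_le_one_iff.2 this)

/-- Solutions of `∂ₜN = -z V(N) ∂_zN` with values in the disc are constant along the
characteristics `u ↦ z exp (-u V (N t z))`, run backwards in time. -/
theorem apply_characteristic_eq (hV : DifferentiableOn ℂ V disc)
    (hV_maps : MapsTo V disc rightHalfPlane)
    (hN : ∀ t, 0 ≤ t → DifferentiableOn ℂ (N t) disc)
    (hN_le : ∀ t, 0 ≤ t → ∀ z ∈ disc, ‖N t z‖ ≤ ‖z‖)
    (hN' : ∀ t, 0 ≤ t → ∀ z ∈ disc,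
      HasDerivWithinAt (fun s => N s z) (-z * V (N t z) * deriv (N t) z) (Ici 0) t)
    {t : ℝ} {z : ℂ} (hz : z ∈ disc) {u : ℝ} (hu : 0 ≤ u) (hut : u ≤ t) :
    N (t - u) (z * Complex.exp (-(u : ℂ) * V (N t z))) = N t z := by
  have ht : 0 ≤ t := hu.trans hut
  have hz1 : ‖z‖ < 1 := by simpa using hz
  set a := N t z with ha
  have hza : ‖a‖ ≤ ‖z‖ := hN_le t ht z hz
  have hadisc : a ∈ disc := by simpa using hza.trans_lt hz1
  have hVa : 0 < (V a).re := hV_maps hadisc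
  -- One radius serves the whole characteristic, which stays in `‖y‖ ≤ ‖z‖`.
  set R : ℝ := 1 - ‖z‖ with hRdef
  have hR : 0 < R := by linarith
  set w : ℝ → ℂ := fun u => z * Complex.exp (-(u : ℂ) * V a) with hwdef
  have hwle : ∀ u, 0 ≤ u → ‖w u‖ ≤ ‖z‖ := fun u hu => norm_mul_exp_neg_le hu hVa.le
  have hball : ∀ u, 0 ≤ u → Metric.ball (w u) R ⊆ disc := by
    intro u hu y hy
    have h1 : ‖y - w u‖ < R := mem_ball_iff_norm.1 hy
    have h2 : ‖y‖ ≤ ‖w u‖ + ‖y - w u‖ := norm_le_norm_add_norm_sub' y (w u)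
    have := hwle u hu
    simp only [disc, Metric.mem_ball, dist_zero_right]
    linarith
  obtain ⟨K, hK⟩ : ∃ K : ℝ, ∀ y ∈ Metric.closedBall (0 : ℂ) ‖z‖, ‖deriv V y‖ ≤ K := by
    apply IsCompact.exists_bound_of_continuousOn (isCompact_closedBall _ _)
    exact (hV.deriv Metric.isOpen_ball).continuousOn.mono (Metric.closedBall_subset_ball hz1)
  have hVlip : ∀ x ∈ Metric.closedBall (0 : ℂ) ‖z‖, ∀ y ∈ Metric.closedBall (0 : ℂ) ‖z‖,
      ‖V y - V x‖ ≤ K * ‖y - x‖ := by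
    intro x hx y hy
    refine (convex_closedBall (0 : ℂ) ‖z‖).norm_image_sub_le_of_norm_deriv_le (𝕜 := ℂ)
      (fun y hy => ?_) hK hx hy
    exact hV.differentiableAt (Metric.isOpen_ball.mem_nhds (Metric.closedBall_subset_ball hz1 hy))
  have hK0 : 0 ≤ K := (norm_nonneg _).trans (hK 0 (by simp))
  have hderiv : ∀ s, 0 ≤ s → ∀ u, 0 ≤ u → ‖deriv (N s) (w u)‖ ≤ 2 / R := by
    intro s hs u hu
    refine Complex.norm_deriv_le_div_of_mapsTo_ball ((hN s hs).mono (hball u hu))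
      (fun y hy => ?_) hR
    rw [mem_closedBall_iff_norm]
    have h1 : ‖y‖ < 1 := by simpa using hball u hu hy
    have h2 : ‖N s y‖ ≤ 1 := (hN_le s hs y (hball u hu hy)).trans h1.le
    have h3 : ‖N s (w u)‖ ≤ 1 := (hN_le s hs _ (by
      simpa using (hwle u hu).trans_lt hz1)).trans ((hwle u hu).trans hz1.le)
    exact (norm_sub_le _ _).trans (by linarith)
  have hwd : ∀ u, HasDerivAt w (-(V a) * w u) u := by
    intro u
    have h1 : HasDerivAt (fun u : ℝ => -(u : ℂ) * V a) (-1 * V a) u :=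
      ((Complex.ofRealCLM.hasDerivAt (x := u)).neg).mul_const _
    convert! (h1.cexp.const_mul z) using 1
    simp only [hwdef]
    ring
  set φ : ℝ → ℂ := fun u => N (t - u) (w u) - a with hφ
  set φ' : ℝ → ℂ := fun u =>
    -(-(w u) * V (N (t - u) (w u)) * deriv (N (t - u)) (w u))
      + deriv (N (t - u)) (w u) * (-(V a) * w u) with hφ'
  -- Time reversal turns derivatives within `Ici 0` into derivatives within `Iic t`, so the
  -- one-sided derivative at time `0` is covered.
  have hrev : ∀ u, u ≤ t → 0 ≤ u → ∀ y ∈ disc, HasDerivWithinAt (fun v => N (t - v) y)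
      (-(-y * V (N (t - u) y) * deriv (N (t - u)) y)) (Iic t) u := by
    intro u hut hu y hy
    have h1 := hN' (t - u) (by linarith) y hy
    have h2 : HasDerivWithinAt (fun v : ℝ => t - v) (-1) (Iic t) u :=
      ((hasDerivAt_id u).const_sub t).hasDerivWithinAt
    have h3 := h1.scomp u h2 (fun v (hv : v ≤ t) => by simpa using hv)
    convert! h3 using 1
    simp
  have hφd : ∀ u ∈ Icc 0 t, HasDerivWithinAt φ (φ' u) (Iic t) u := by
    intro u hu
    have hwu : w u ∈ disc := by simpa using (hwle u hu.1).trans_lt hz1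
    refine HasDerivWithinAt.sub_const a ?_
    refine hasDerivWithinAt_apply_curve (f := fun v => N (t - v)) (B := 1) hR ?_ ?_ hu.2 ?_ ?_ ?_
    · intro v hv
      exact (hN _ (by simpa using hv)).mono (hball u hu.1)
    · intro v hv y hy
      have h1 : ‖y‖ < 1 := by simpa using hball u hu.1 hy
      exact (hN_le (t - v) (by simpa using hv) y (hball u hu.1 hy)).trans h1.le
    · intro y hy
      exact (hrev u hu.2 hu.1 y (hball u hu.1 hy)).continuousWithinAt
    · exact hrev u hu.2 hu.1 _ hwu
    · exact (hwd u).hasDerivWithinAt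
  have hφ0 : φ 0 = 0 := by simp [hφ, hwdef, ha]
  -- The speed of the curve uses the frozen value `V a`, so the two terms of `φ'` combine to a
  -- multiple of `V (N (t - u) (w u)) - V a`. The Lipschitz bound for `V` then gives a Grönwall
  -- inequality with zero initial value.
  have hbound : ∀ u ∈ Ico 0 t, ‖φ' u‖ ≤ (2 / R * K) * ‖φ u‖ := by
    intro u hu
    have htu : 0 ≤ t - u := by linarith [hu.2]
    have h1 : φ' u = w u * deriv (N (t - u)) (w u) * (V (N (t - u) (w u)) - V a) := by
      simp only [hφ']
      ring
    have hwu := hwle u hu.1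
    have h2 : ‖V (N (t - u) (w u)) - V a‖ ≤ K * ‖φ u‖ := by
      refine hVlip a (by simpa using hza) _ ?_
      simpa using (hN_le _ htu (w u) (by simpa using hwu.trans_lt hz1)).trans hwu
    rw [h1, norm_mul, norm_mul, mul_assoc (2 / R)]
    refine mul_le_mul ?_ h2 (norm_nonneg _) (by positivity)
    have h3 := hderiv (t - u) htu u hu.1
    calc ‖w u‖ * ‖deriv (N (t - u)) (w u)‖ ≤ 1 * ‖deriv (N (t - u)) (w u)‖ := by
          gcongr
          linarith
      _ ≤ 2 / R := by rw [one_mul]; exact h3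
  have := eq_zero_of_abs_deriv_le_mul_abs_self_of_eq_zero_right (a := 0) (b := t)
    (fun u hu => ((hφd u hu).mono (fun v hv => hv.2)).continuousWithinAt)
    (fun u hu => (hφd u ⟨hu.1, hu.2.le⟩).mono_of_mem_nhdsWithin
      (nhdsWithin_le_nhds (Iic_mem_nhds hu.2))) hφ0 hbound u ⟨hu, hut⟩
  exact sub_eq_zero.1 this

end Transport

/-! ### Passage between the half-plane and the disc -/

section Cayley

/-- The Cayley transform from the right half-plane to the disc. -/
def cayley (m : ℂ) : ℂ := (m - 1) / (m + 1)

/-- The inverse Cayley transform. -/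
def cayleyInv (n : ℂ) : ℂ := (1 + n) / (1 - n)

theorem add_one_ne_zero_of_re_pos {m : ℂ} (hm : 0 < m.re) : m + 1 ≠ 0 := by
  intro h
  have := congrArg Complex.re h
  simp at this
  linarith

theorem one_sub_ne_zero_of_mem_disc {n : ℂ} (hn : n ∈ disc) : 1 - n ≠ 0 := by
  intro h
  have : n = 1 := (sub_eq_zero.1 h).symm
  simp [this] at hn

theorem cayleyInv_cayley {m : ℂ} (hm : 0 < m.re) : cayleyInv (cayley m) = m := by
  have h := add_one_ne_zero_of_re_pos hm
  rw [cayleyInv, cayley]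
  have h1 : 1 + (m - 1) / (m + 1) = 2 * m / (m + 1) := by field_simp; ring
  have h2 : 1 - (m - 1) / (m + 1) = 2 / (m + 1) := by field_simp; ring
  rw [h1, h2]
  field_simp

theorem cayley_mem_disc {m : ℂ} (hm : 0 < m.re) : cayley m ∈ disc := by
  have h := add_one_ne_zero_of_re_pos hm
  rw [mem_ball_zero_iff, cayley, norm_div, div_lt_one (norm_pos_iff.2 h),
    ← sq_lt_sq₀ (norm_nonneg _) (norm_nonneg _), ← Complex.normSq_eq_norm_sq,
    ← Complex.normSq_eq_norm_sq, Complex.normSq_apply, Complex.normSq_apply]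
  simp
  nlinarith

theorem cayleyInv_re_pos {n : ℂ} (hn : n ∈ disc) : 0 < (cayleyInv n).re := by
  have h := one_sub_ne_zero_of_mem_disc hn
  have hn1 : Complex.normSq n < 1 := by
    rw [Complex.normSq_eq_norm_sq]
    have : ‖n‖ < 1 := by simpa using hn
    nlinarith [norm_nonneg n]
  have h1 := Complex.normSq_pos.2 h
  rw [cayleyInv, Complex.div_re, ← add_div]
  apply div_pos _ h1
  rw [Complex.normSq_apply] at hn1
  simp
  nlinarith

theorem differentiableOn_cayleyInv : DifferentiableOn ℂ cayleyInv disc := by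
  intro n hn
  have h := one_sub_ne_zero_of_mem_disc hn
  apply DifferentiableAt.differentiableWithinAt
  unfold cayleyInv
  fun_prop (disch := assumption)

theorem hasDerivAt_cayley {m : ℂ} (hm : 0 < m.re) : HasDerivAt cayley (2 / (m + 1) ^ 2) m := by
  have h := add_one_ne_zero_of_re_pos hm
  have := ((hasDerivAt_id m).sub_const 1).div ((hasDerivAt_id m).add_const 1) h
  convert! this using 1
  simp only [id]
  ring

end Cayley

/-! ### Constancy along characteristics and the Loewner chain -/

namespace IsSolution

variable {S : ℂ → ℂ} {α : ProbabilityMeasure Circle} {M : ℝ → ℂ → ℂ}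

theorem zero_mem_disc : (0 : ℂ) ∈ disc := by simp

/-- The factor `z` in the equation makes the value at the origin stationary, and a probability
measure has Herglotz value `1` there. -/
theorem apply_zero (hM : IsSolution S α M) {t : ℝ} (ht : 0 ≤ t) : M t 0 = 1 := by
  have h0 : M 0 0 = 1 := by
    rw [hM.initial 0 zero_mem_disc, herglotz]
    simp
  rw [← h0]
  refine constant_of_has_deriv_right_zero (f := fun s => M s 0) (a := 0) (b := t) ?_ ?_ t
    ⟨ht, le_rfl⟩
  · intro s hs
    exact ((hM.hasDerivWithinAt s hs.1 0 zero_mem_disc).mono (fun v hv => hv.1)).continuousWithinAt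
  · intro s hs
    have := hM.hasDerivWithinAt s hs.1 0 zero_mem_disc
    rw [neg_zero, zero_mul, zero_mul] at this
    exact this.mono (Ici_subset_Ici.2 hs.1)

/-- A solution is constant along characteristics, run backwards in time. -/
theorem apply_characteristic (hM : IsSolution S α M) (hS : DifferentiableOn ℂ S rightHalfPlane)
    (hS_maps : MapsTo S rightHalfPlane rightHalfPlane)
    {t : ℝ} {z : ℂ} (hz : z ∈ disc) {u : ℝ} (hu : 0 ≤ u) (hut : u ≤ t) :
    M (t - u) (z * Complex.exp (-(u : ℂ) * S (M t z))) = M t z := by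
  have hmaps : ∀ s, 0 ≤ s → ∀ y ∈ disc, 0 < (M s y).re := fun s hs y hy => hM.mapsTo s hs hy
  have hdiff : ∀ s, 0 ≤ s → ∀ y ∈ disc, HasDerivAt (M s) (deriv (M s) y) y := fun s hs y hy =>
    ((hM.differentiableOn s hs).differentiableAt (Metric.isOpen_ball.mem_nhds hy)).hasDerivAt
  have hNd : ∀ s, 0 ≤ s → ∀ y ∈ disc, HasDerivAt (fun x => cayley (M s x))
      (2 / (M s y + 1) ^ 2 * deriv (M s) y) y := fun s hs y hy =>
    (hasDerivAt_cayley (hmaps s hs y hy)).comp y (hdiff s hs y hy)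
  have hNdiff : ∀ s, 0 ≤ s → DifferentiableOn ℂ (fun x => cayley (M s x)) disc :=
    fun s hs y hy => (hNd s hs y hy).differentiableAt.differentiableWithinAt
  have ht : 0 ≤ t := hu.trans hut
  -- The Cayley transform sends `1` to `0`, so the transformed solution fixes the origin and the
  -- Schwarz lemma supplies `‖N s y‖ ≤ ‖y‖`.
  have key := apply_characteristic_eq (V := fun n => S (cayleyInv n))
    (N := fun s x => cayley (M s x)) (hS.comp differentiableOn_cayleyInv
      (fun n hn => cayleyInv_re_pos hn)) (fun n hn => hS_maps (cayleyInv_re_pos hn)) hNdiff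
    (fun s hs y hy => Complex.norm_le_norm_of_mapsTo_ball (hNdiff s hs)
      (fun x hx => Metric.ball_subset_closedBall (cayley_mem_disc (hmaps s hs x hx)))
      (by simp [hM.apply_zero hs, cayley]) (by simpa using hy))
    (fun s hs y hy => by
      rw [(hNd s hs y hy).deriv, cayleyInv_cayley (hmaps s hs y hy)]
      have := (hasDerivAt_cayley (hmaps s hs y hy)).comp_hasDerivWithinAt s
        (hM.hasDerivWithinAt s hs y hy)
      convert! this using 1
      ring) hz hu hut
  simp only [cayleyInv_cayley (hmaps t ht z hz)] at key
  have hw : z * Complex.exp (-(u : ℂ) * S (M t z)) ∈ disc := by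
    have h1 : ‖z‖ < 1 := by simpa using hz
    have h2 : 0 < (S (M t z)).re := hS_maps (hmaps t ht z hz)
    simpa using (norm_mul_exp_neg_le (z := z) hu h2.le).trans_lt h1
  rw [← cayleyInv_cayley (hmaps (t - u) (by linarith) _ hw), key,
    cayleyInv_cayley (hmaps t ht z hz)]

/-- The Loewner chain `g t z = z exp (-t S (M t z))` of a solution. -/
def loewnerChain (S : ℂ → ℂ) (M : ℝ → ℂ → ℂ) (t : ℝ) (z : ℂ) : ℂ :=
  z * Complex.exp (-(t : ℂ) * S (M t z))

theorem apply_zero_loewnerChain (hM : IsSolution S α M)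
    (hS : DifferentiableOn ℂ S rightHalfPlane)
    (hS_maps : MapsTo S rightHalfPlane rightHalfPlane)
    {t : ℝ} (ht : 0 ≤ t) {z : ℂ} (hz : z ∈ disc) : M 0 (loewnerChain S M t z) = M t z := by
  have := hM.apply_characteristic hS hS_maps hz ht le_rfl
  rwa [sub_self] at this

theorem differentiableOn_loewnerChain (hM : IsSolution S α M)
    (hS : DifferentiableOn ℂ S rightHalfPlane) {t : ℝ} (ht : 0 ≤ t) :
    DifferentiableOn ℂ (loewnerChain S M t) disc := by
  have h1 : DifferentiableOn ℂ (fun z => S (M t z)) disc :=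
    hS.comp (hM.differentiableOn t ht) (hM.mapsTo t ht)
  exact differentiableOn_id.mul (h1.const_mul _).cexp

theorem isDecreasingLoewnerChain_loewnerChain (hM : IsSolution S α M)
    (hS : DifferentiableOn ℂ S rightHalfPlane)
    (hS_maps : MapsTo S rightHalfPlane rightHalfPlane) :
    IsDecreasingLoewnerChain (loewnerChain S M) where
  differentiableOn t ht := hM.differentiableOn_loewnerChain hS ht
  injOn t ht z hz y hy h := by
    have h1 : M t z = M t y := by
      rw [← hM.apply_zero_loewnerChain hS hS_maps ht hz, h,
        hM.apply_zero_loewnerChain hS hS_maps ht hy]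
    rw [loewnerChain, loewnerChain, h1] at h
    exact mul_right_cancel₀ (Complex.exp_ne_zero _) h
  map_zero t ht := by simp [loewnerChain]
  image_subset s t hs hst := by
    rintro _ ⟨z, hz, rfl⟩
    have hc := hM.apply_characteristic hS hS_maps hz (sub_nonneg.2 hst) (by linarith)
    rw [sub_sub_cancel] at hc
    -- The preimage under `g s` is the position at time `s` of the characteristic through `z` at
    -- time `t`; `M` has the same value there, so the exponents add.
    refine ⟨z * Complex.exp (-((t - s : ℝ) : ℂ) * S (M t z)), ?_, ?_⟩
    · have h1 : ‖z‖ < 1 := by simpa using hz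
      have h2 : 0 < (S (M t z)).re := hS_maps (hM.mapsTo t (hs.trans hst) hz)
      simpa using (norm_mul_exp_neg_le (z := z) (sub_nonneg.2 hst) h2.le).trans_lt h1
    · rw [loewnerChain, hc, loewnerChain, mul_assoc, ← Complex.exp_add]
      congr 2
      push_cast
      ring
  initial z hz := by simp [loewnerChain]
  deriv_zero := by
    refine ⟨S 1, hS_maps (by simp), fun t ht => ?_⟩
    have h1 : DifferentiableAt ℂ (fun z => Complex.exp (-(t : ℂ) * S (M t z))) 0 := by
      have : DifferentiableOn ℂ (fun z => S (M t z)) disc :=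
        hS.comp (hM.differentiableOn t ht) (hM.mapsTo t ht)
      exact ((this.const_mul _).cexp).differentiableAt (Metric.ball_mem_nhds _ one_pos)
    have h2 := (hasDerivAt_id (0 : ℂ)).mul h1.hasDerivAt
    have h3 : loewnerChain S M t = id * fun z => Complex.exp (-(t : ℂ) * S (M t z)) := rfl
    rw [h3, h2.deriv]
    simp [hM.apply_zero ht]

theorem isDecreasingSubordinationChain (hM : IsSolution S α M)
    (hS : DifferentiableOn ℂ S rightHalfPlane)
    (hS_maps : MapsTo S rightHalfPlane rightHalfPlane) : IsDecreasingSubordinationChain M where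
  differentiableOn := hM.differentiableOn
  map_zero t ht := by rw [hM.apply_zero ht, hM.apply_zero le_rfl]
  exists_chain := ⟨loewnerChain S M, hM.isDecreasingLoewnerChain_loewnerChain hS hS_maps,
    fun _ ht _ hz => (hM.apply_zero_loewnerChain hS hS_maps ht hz).symm⟩

end IsSolution

theorem continuous_circle_coe : Continuous fun x : Circle => (x : ℂ) := continuous_subtype_val

theorem norm_circle_coe_le (x : Circle) : ‖(x : ℂ)‖ ≤ 1 := x.norm_coe.le

/-! ### Integration against the uniform distribution -/

section Uniform

theorem integral_uniformMeasure {E : Type*} [NormedAddCommGroup E] [NormedSpace ℝ E] {f : ℂ → E} (hf : Continuous fun x : Circle => f x) :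
    ∫ x : Circle, f x ∂uniformMeasure = Real.circleAverage f 0 1 := by
  rw [uniformMeasure, integral_map Circle.exp.continuous.measurable.aemeasurable
    hf.aestronglyMeasurable, integral_smul_measure, Real.circleAverage,
    intervalIntegral.integral_of_le (by positivity)]
  congr 1
  · rw [ENNReal.toReal_inv, ENNReal.toReal_ofReal (by positivity)]
  · simp [circleMap]

theorem integrable_of_continuous_circle {E : Type*} [NormedAddCommGroup E] {μ : Measure Circle} [IsFiniteMeasure μ] {f : Circle → E}
    (hf : Continuous f) : Integrable f μ :=
  hf.integrable_of_hasCompactSupport (HasCompactSupport.of_compactSpace f)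

instance instIsOpenPosMeasureUniform : uniformMeasure.IsOpenPosMeasure := by
  constructor
  intro U hU hne
  obtain ⟨x, hx⟩ := hne
  have hm : Measurable (fun θ : ℝ => Circle.exp θ) := Circle.exp.continuous.measurable
  have hpre : IsOpen ((fun θ : ℝ => Circle.exp θ) ⁻¹' U) := hU.preimage Circle.exp.continuous
  have hne : ((fun θ : ℝ => Circle.exp θ) ⁻¹' U ∩ Ioo 0 (2 * Real.pi)).Nonempty := by
    obtain ⟨θ, hθ, hθx⟩ : ∃ θ ∈ Icc 0 (2 * Real.pi), Circle.exp θ = x := by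
      have h1 := Complex.neg_pi_lt_arg (x : ℂ)
      have h2 := Complex.arg_le_pi (x : ℂ)
      have hpi := Real.pi_pos
      rcases le_total 0 (Complex.arg (x : ℂ)) with h | h
      · exact ⟨_, ⟨h, by linarith⟩, Circle.exp_arg x⟩
      · refine ⟨Complex.arg (x : ℂ) + 2 * Real.pi, ⟨by linarith, by linarith⟩, ?_⟩
        rw [Circle.exp_add_two_pi, Circle.exp_arg]
    -- The point `1` is reached only at the endpoints of the angular interval, so openness is used
    -- to move the angle into the interior.
    rw [← closure_Ioo (by positivity : (0 : ℝ) ≠ 2 * Real.pi), mem_closure_iff] at hθ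
    exact hθ _ hpre (by simpa [hθx] using hx)
  have hpos : volume ((fun θ : ℝ => Circle.exp θ) ⁻¹' U ∩ Ioo 0 (2 * Real.pi)) ≠ 0 :=
    (hpre.inter isOpen_Ioo).measure_ne_zero volume hne
  rw [uniformMeasure, Measure.map_apply hm hU.measurableSet, Measure.smul_apply,
    Measure.restrict_apply (hm hU.measurableSet), smul_eq_mul]
  refine mul_ne_zero (ENNReal.inv_ne_zero.2 ENNReal.ofReal_ne_top) fun h0 => hpos (measure_mono_null ?_ h0)
  gcongr
  exact Ioo_subset_Ioc_self

end Uniform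

/-! ### The Schwarz formula and measures with harmonic density -/

section Density

theorem sub_ne_zero_of_mem_disc {z : ℂ} (hz : z ∈ disc) (x : Circle) : (x : ℂ) - z ≠ 0 := by
  intro h
  rw [← sub_eq_zero.1 h, mem_ball_zero_iff, Circle.norm_coe] at hz
  exact lt_irrefl _ hz

theorem continuous_herglotz_kernel {z : ℂ} (hz : z ∈ disc) :
    Continuous fun x : Circle => ((x : ℂ) + z) / ((x : ℂ) - z) :=
  (by fun_prop : Continuous fun x : Circle => (x : ℂ) + z).div (by fun_prop)
    (sub_ne_zero_of_mem_disc hz)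

variable {F : ℂ → ℂ}

theorem continuous_circle_of_diffContOnCl (hF : DiffContOnCl ℂ F disc) :
    Continuous fun x : Circle => F x := by
  have h := hF.continuousOn
  rw [closure_ball (0 : ℂ) one_ne_zero] at h
  exact h.comp_continuous continuous_circle_coe fun x =>
    mem_closedBall_zero_iff.2 (norm_circle_coe_le x)

theorem integral_uniformMeasure_eq_apply_zero (hF : DiffContOnCl ℂ F disc) :
    ∫ x : Circle, F x ∂uniformMeasure = F 0 := by
  rw [integral_uniformMeasure (continuous_circle_of_diffContOnCl hF)]
  exact DiffContOnCl.circleAverage (by simpa using hF)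

/-- The Schwarz integral formula. -/
theorem integral_re_smul_herglotz_kernel (hF : DiffContOnCl ℂ F disc) (h0 : (F 0).im = 0)
    {z : ℂ} (hz : z ∈ disc) :
    ∫ x : Circle, (F x).re • (((x : ℂ) + z) / ((x : ℂ) - z)) ∂uniformMeasure = F z := by
  have hFc := continuous_circle_of_diffContOnCl hF
  have hkc := continuous_herglotz_kernel hz
  have hcc : Continuous fun x : Circle => (x : ℂ) / ((x : ℂ) - z) :=
    (by fun_prop : Continuous fun x : Circle => (x : ℂ)).div (by fun_prop)
      (sub_ne_zero_of_mem_disc hz)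
  have hA : ∫ x : Circle, (x : ℂ) / ((x : ℂ) - z) * F x ∂uniformMeasure = F z := by
    have h1 := DiffContOnCl.circleAverage_smul_div (R := 1) (c := 0) (w := z)
      (by simpa using hF) (by simpa using hz)
    rw [← integral_uniformMeasure (by simpa [Pi.mul_def] using hcc.mul hFc)] at h1
    simpa using h1
  have hP : ∫ x : Circle, ((((x : ℂ) + z) / ((x : ℂ) - z)).re : ℂ) * F x ∂uniformMeasure
      = F z := by
    have h1 := DiffContOnCl.circleAverage_re_herglotzRieszKernel_smul' (R := 1) (c := 0) (w := z)
      hF hz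
    rw [← integral_uniformMeasure (by
      simpa [Pi.mul_def, Function.comp_def] using (Complex.continuous_ofReal.comp (Complex.continuous_re.comp hkc)).mul hFc)] at h1
    simpa using h1
  have hB := integral_uniformMeasure_eq_apply_zero hF
  -- The kernel is `2 * x / (x - z) - 1`: Cauchy's formula handles the first term, the mean value
  -- property the second.
  have hK : ∫ x : Circle, ((x : ℂ) + z) / ((x : ℂ) - z) * F x ∂uniformMeasure
      = 2 * F z - F 0 := by
    rw [← hA, ← hB, ← integral_const_mul, hB, ← hB, ← integral_sub]
    · congr 1
      ext x
      have := sub_ne_zero_of_mem_disc hz x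
      field_simp
      ring
    · exact integrable_of_continuous_circle ((hcc.mul hFc).const_mul _)
    · exact integrable_of_continuous_circle hFc
  have hreal : (starRingEnd ℂ) (F 0) = F 0 := Complex.conj_eq_iff_im.2 h0
  -- Writing `Re F = (F + conj F) / 2`, the term `k * conj F / 2` equals `conj (Re k * F) - conj (k
  -- * F) / 2`. Only integrals of `F` against `k` and `Re k` remain, and the leftover `F 0` terms
  -- cancel because `F 0` is real.
  have hpt : ∀ x : Circle, (F x).re • (((x : ℂ) + z) / ((x : ℂ) - z))
      = (1 / 2) * (((x : ℂ) + z) / ((x : ℂ) - z) * F x)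
        + (starRingEnd ℂ) (((((x : ℂ) + z) / ((x : ℂ) - z)).re : ℂ) * F x)
        - (1 / 2) * (starRingEnd ℂ) (((x : ℂ) + z) / ((x : ℂ) - z) * F x) := by
    intro x
    generalize ((x : ℂ) + z) / ((x : ℂ) - z) = k
    apply Complex.ext <;> simp <;> ring
  simp_rw [hpt]
  rw [integral_sub, integral_add, integral_const_mul, integral_const_mul, integral_conj,
    integral_conj, hK, hP, map_sub, map_mul, hreal]
  · rw [map_ofNat]
    ring
  all_goals
    apply integrable_of_continuous_circle
    have := Complex.continuous_ofReal.comp (Complex.continuous_re.comp hkc)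
    have h2 : Continuous (starRingEnd ℂ) := Complex.continuous_conj
    first
    | exact (hkc.mul hFc).const_mul _
    | exact h2.comp (this.mul hFc)
    | exact (h2.comp (hkc.mul hFc)).const_mul _
    | exact ((hkc.mul hFc).const_mul _).add (h2.comp (this.mul hFc))

/-- The measure with density `Re F` with respect to the uniform distribution. -/
def densityMeasure (F : ℂ → ℂ) : Measure Circle :=
  uniformMeasure.withDensity fun x => ENNReal.ofReal (F x).re

theorem measurable_density (hF : DiffContOnCl ℂ F disc) :
    Measurable fun x : Circle => ENNReal.ofReal (F x).re :=
  (Complex.continuous_re.comp (continuous_circle_of_diffContOnCl hF)).measurable.ennreal_ofReal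

theorem integral_densityMeasure {E : Type*} [NormedAddCommGroup E] [NormedSpace ℝ E]
    (hF : DiffContOnCl ℂ F disc) (hre : ∀ x : Circle, 0 ≤ (F x).re) (f : Circle → E) :
    ∫ x, f x ∂(densityMeasure F) = ∫ x : Circle, (F x).re • f x ∂uniformMeasure := by
  rw [densityMeasure, integral_withDensity_eq_integral_toReal_smul (measurable_density hF)
    (by simp)]
  simp_rw [ENNReal.toReal_ofReal (hre _)]

theorem isProbabilityMeasure_densityMeasure (hF : DiffContOnCl ℂ F disc)
    (hre : ∀ x : Circle, 0 ≤ (F x).re) (h0 : F 0 = 1) :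
    IsProbabilityMeasure (densityMeasure F) := by
  have hFc := continuous_circle_of_diffContOnCl hF
  constructor
  have hint : Integrable (fun x : Circle => (F x).re) uniformMeasure :=
    integrable_of_continuous_circle (Complex.continuous_re.comp hFc)
  rw [densityMeasure, withDensity_apply _ MeasurableSet.univ, Measure.restrict_univ,
    ← ofReal_integral_eq_lintegral_ofReal hint (Eventually.of_forall hre)]
  have h1 : ∫ x : Circle, (F x).re ∂uniformMeasure = (∫ x : Circle, F x ∂uniformMeasure).re :=
    integral_re (integrable_of_continuous_circle hFc)
  rw [h1, integral_uniformMeasure_eq_apply_zero hF, h0]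
  simp

/-- The probability measure with density `Re F`. -/
def densityProbabilityMeasure (hF : DiffContOnCl ℂ F disc) (hre : ∀ x : Circle, 0 ≤ (F x).re)
    (h0 : F 0 = 1) : ProbabilityMeasure Circle :=
  ⟨densityMeasure F, isProbabilityMeasure_densityMeasure hF hre h0⟩

theorem herglotz_densityProbabilityMeasure (hF : DiffContOnCl ℂ F disc)
    (hre : ∀ x : Circle, 0 ≤ (F x).re) (h0 : F 0 = 1) :
    EqOn F (herglotz (densityProbabilityMeasure hF hre h0)) disc := by
  intro z hz
  have := integral_densityMeasure hF hre fun x : Circle => ((x : ℂ) + z) / ((x : ℂ) - z)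
  rw [integral_re_smul_herglotz_kernel hF (by simp [h0]) hz] at this
  exact this.symm

theorem densityMeasure_absolutelyContinuous : densityMeasure F ≪ uniformMeasure :=
  withDensity_absolutelyContinuous _ _

/-- A strictly positive density makes the two measures mutually absolutely continuous, and the
uniform measure charges every nonempty open set. -/
theorem support_densityMeasure (hF : DiffContOnCl ℂ F disc) (hre : ∀ x : Circle, 0 < (F x).re) :
    (densityMeasure F).support = univ := by
  have h1 : uniformMeasure ≪ densityMeasure F :=
    withDensity_absolutelyContinuous' (measurable_density hF).aemeasurable
      (Eventually.of_forall fun x => (ENNReal.ofReal_pos.2 (hre x)).ne')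
  have h2 := h1.support_mono
  rw [Measure.support_eq_univ] at h2
  exact univ_subset_iff.1 h2

end Density

/-! ### Herglotz representation by dilation and compactness -/

section Existence

theorem tendsto_herglotz {ι : Type*} {l : Filter ι} {ν : ι → ProbabilityMeasure Circle}
    {μ : ProbabilityMeasure Circle} (h : Tendsto ν l (𝓝 μ)) {z : ℂ} (hz : z ∈ disc) :
    Tendsto (fun i => herglotz (ν i) z) l (𝓝 (herglotz μ z)) :=
  (ProbabilityMeasure.tendsto_iff_forall_integral_rclike_tendsto ℂ).1 h
    (BoundedContinuousFunction.mkOfCompact ⟨_, continuous_herglotz_kernel hz⟩)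

/-- The Herglotz representation theorem. -/
theorem exists_herglotz {M : ℂ → ℂ} (hM : DifferentiableOn ℂ M disc)
    (hM_maps : MapsTo M disc rightHalfPlane) (h0 : M 0 = 1) :
    ∃ μ : ProbabilityMeasure Circle, EqOn M (herglotz μ) disc := by
  let r : ℕ → ℝ := fun n => 1 - 1 / ((n : ℝ) + 1)
  have hr0 : ∀ n, 0 ≤ r n := fun n => by
    simp only [r, sub_nonneg]
    rw [div_le_one (by positivity)]
    linarith [n.cast_nonneg (α := ℝ)]
  have hr1 : ∀ n, r n < 1 := fun n => by
    simp only [r]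
    linarith [show 0 < 1 / ((n : ℝ) + 1) by positivity]
  have hrlim : Tendsto r atTop (𝓝 1) := by
    simpa [r] using (tendsto_one_div_add_atTop_nhds_zero_nat (𝕜 := ℝ)).const_sub 1
  have hmem : ∀ n, ∀ z ∈ Metric.closedBall (0 : ℂ) 1, (r n : ℂ) * z ∈ disc := by
    intro n z hz
    have h1 : ‖z‖ ≤ 1 := by simpa using hz
    rw [mem_ball_zero_iff, norm_mul, Complex.norm_real, Real.norm_of_nonneg (hr0 n)]
    nlinarith [hr0 n, hr1 n, norm_nonneg z]
  have hF : ∀ n, DiffContOnCl ℂ (fun z => M (r n * z)) disc := by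
    intro n
    apply DifferentiableOn.diffContOnCl
    rw [closure_ball (0 : ℂ) one_ne_zero]
    exact hM.comp (by fun_prop) (hmem n)
  have hre : ∀ n, ∀ x : Circle, 0 ≤ (M (r n * x)).re := fun n x =>
    (show 0 < (M (r n * x)).re from hM_maps (hmem n x
      (mem_closedBall_zero_iff.2 (norm_circle_coe_le x)))).le
  have hF0 : ∀ n, M (r n * 0) = 1 := by simp [h0]
  let ν : ℕ → ProbabilityMeasure Circle := fun n =>
    densityProbabilityMeasure (hF n) (hre n) (hF0 n)
  -- Compactness of the space of probability measures gives a weak limit along an ultrafilter, so no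
  -- subsequence is extracted.
  let U : Ultrafilter ℕ := hyperfilter ℕ
  have hU : (U : Filter ℕ) ≤ atTop := Nat.hyperfilter_le_atTop
  obtain ⟨μ, -, hμ⟩ := isCompact_univ.ultrafilter_le_nhds (U.map ν) (by simp)
  refine ⟨μ, fun z hz => ?_⟩
  have h1 : Tendsto (fun n => herglotz (ν n) z) U (𝓝 (herglotz μ z)) :=
    tendsto_herglotz hμ hz
  have h2 : Tendsto (fun n => herglotz (ν n) z) U (𝓝 (M z)) := by
    have h3 : Tendsto (fun n => (r n : ℂ) * z) atTop (𝓝 z) := by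
      simpa using ((Complex.continuous_ofReal.tendsto 1).comp hrlim).mul_const z
    have h4 := ((hM.continuousOn.continuousAt (Metric.isOpen_ball.mem_nhds hz)).tendsto.comp
      h3).mono_left hU
    refine h4.congr fun n => ?_
    exact herglotz_densityProbabilityMeasure (hF n) (hre n) (hF0 n) hz
  exact tendsto_nhds_unique h2 h1

end Existence

/-! ### Uniqueness of the Herglotz measure through its Fourier coefficients -/

section Uniqueness

variable {μ ν : ProbabilityMeasure Circle}

theorem integral_mul_inv_sub_eq (h : EqOn (herglotz μ) (herglotz ν) disc) {z : ℂ}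
    (hz : z ∈ disc) :
    ∫ x : Circle, (x : ℂ) / ((x : ℂ) - z) ∂(μ : Measure Circle)
      = ∫ x : Circle, (x : ℂ) / ((x : ℂ) - z) ∂(ν : Measure Circle) := by
  have key : ∀ ρ : ProbabilityMeasure Circle,
      ∫ x : Circle, (x : ℂ) / ((x : ℂ) - z) ∂(ρ : Measure Circle) = (herglotz ρ z + 1) / 2 := by
    intro ρ
    have h1 : ∀ x : Circle, (x : ℂ) / ((x : ℂ) - z)
        = (((x : ℂ) + z) / ((x : ℂ) - z) + 1) / 2 := by
      intro x
      have := sub_ne_zero_of_mem_disc hz x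
      field_simp
      ring
    simp_rw [h1]
    rw [integral_div, integral_add (integrable_of_continuous_circle (continuous_herglotz_kernel hz))
      (integrable_const _)]
    simp [herglotz]
  rw [key, key, h hz]

theorem continuous_inv_pow_mul {z : ℂ} (hz : z ∈ disc) (n : ℕ) :
    Continuous fun x : Circle => ((x : ℂ)⁻¹) ^ n * ((x : ℂ) / ((x : ℂ) - z)) := by
  refine Continuous.mul ?_ ((by fun_prop : Continuous fun x : Circle => (x : ℂ)).div
    (by fun_prop) (sub_ne_zero_of_mem_disc hz))
  exact (Continuous.inv₀ (by fun_prop) fun x => x.coe_ne_zero).pow n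

/-- Moments are peeled off one at a time from `x / (x - z) = 1 + z * x⁻¹ * (x / (x - z))`: letting
`z → 0` isolates a moment, and cancelling it and dividing by `z` passes to the next transform. -/
theorem integral_inv_pow_eq (h : EqOn (herglotz μ) (herglotz ν) disc) (n : ℕ) :
    ∫ x : Circle, ((x : ℂ)⁻¹) ^ n ∂(μ : Measure Circle)
      = ∫ x : Circle, ((x : ℂ)⁻¹) ^ n ∂(ν : Measure Circle) := by
  have step : ∀ (ρ : ProbabilityMeasure Circle) (n : ℕ), ∀ z ∈ disc,
      ∫ x : Circle, ((x : ℂ)⁻¹) ^ n * ((x : ℂ) / ((x : ℂ) - z)) ∂(ρ : Measure Circle)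
        = ∫ x : Circle, ((x : ℂ)⁻¹) ^ n ∂(ρ : Measure Circle)
          + z * ∫ x : Circle, ((x : ℂ)⁻¹) ^ (n + 1) * ((x : ℂ) / ((x : ℂ) - z))
            ∂(ρ : Measure Circle) := by
    intro ρ n z hz
    rw [← integral_const_mul, ← integral_add]
    · congr 1
      ext x
      have := sub_ne_zero_of_mem_disc hz x
      have hx := x.coe_ne_zero
      rw [pow_succ]
      field_simp
      ring
    · exact integrable_of_continuous_circle
        ((Continuous.inv₀ (by fun_prop) fun x : Circle => x.coe_ne_zero).pow n)
    · exact integrable_of_continuous_circle ((continuous_inv_pow_mul hz _).const_mul z)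
  have bound : ∀ (ρ : ProbabilityMeasure Circle) (n : ℕ) (z : ℂ), ‖z‖ ≤ 1 / 2 →
      ‖∫ x : Circle, ((x : ℂ)⁻¹) ^ n * ((x : ℂ) / ((x : ℂ) - z)) ∂(ρ : Measure Circle)‖ ≤ 2 := by
    intro ρ n z hz
    refine (norm_integral_le_of_norm_le_const (C := 2) (Eventually.of_forall fun x => ?_)).trans
      (by simp)
    have h1 : (1 : ℝ) / 2 ≤ ‖(x : ℂ) - z‖ := by
      have := norm_sub_norm_le (x : ℂ) z
      rw [Circle.norm_coe] at this
      linarith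
    rw [norm_mul, norm_pow, norm_inv, norm_div, Circle.norm_coe, inv_one, one_pow, one_mul,
      div_le_iff₀ (by linarith)]
    linarith
  -- equality of the transforms gives equality of the moments
  have moment : ∀ n : ℕ, (∀ z ∈ disc, z ≠ 0 →
      ∫ x : Circle, ((x : ℂ)⁻¹) ^ n * ((x : ℂ) / ((x : ℂ) - z)) ∂(μ : Measure Circle)
        = ∫ x : Circle, ((x : ℂ)⁻¹) ^ n * ((x : ℂ) / ((x : ℂ) - z)) ∂(ν : Measure Circle)) →
      ∫ x : Circle, ((x : ℂ)⁻¹) ^ n ∂(μ : Measure Circle)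
        = ∫ x : Circle, ((x : ℂ)⁻¹) ^ n ∂(ν : Measure Circle) := by
    intro n hn
    by_contra hne
    have hpos : 0 < ‖∫ x : Circle, ((x : ℂ)⁻¹) ^ n ∂(μ : Measure Circle)
        - ∫ x : Circle, ((x : ℂ)⁻¹) ^ n ∂(ν : Measure Circle)‖ := norm_pos_iff.2 (sub_ne_zero.2 hne)
    set d := ‖∫ x : Circle, ((x : ℂ)⁻¹) ^ n ∂(μ : Measure Circle)
        - ∫ x : Circle, ((x : ℂ)⁻¹) ^ n ∂(ν : Measure Circle)‖
    -- Each remainder integral is at most `2` for `‖z‖ ≤ 1/2`, so `d ≤ 4 * ε ≤ d / 2`, contradicting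
    -- `d > 0`.
    obtain ⟨ε, hε, hε2, hεd⟩ : ∃ ε : ℝ, 0 < ε ∧ ε ≤ 1 / 2 ∧ ε ≤ d / 8 :=
      ⟨min (1 / 2) (d / 8), by positivity, min_le_left _ _, min_le_right _ _⟩
    have hnε : ‖(ε : ℂ)‖ = ε := by simp [abs_of_pos hε]
    have hεdisc : (ε : ℂ) ∈ disc := by
      rw [mem_ball_zero_iff, hnε]
      linarith
    have h1 := hn ε hεdisc (by exact_mod_cast hε.ne')
    rw [step μ n ε hεdisc, step ν n ε hεdisc] at h1
    have h2 : ∫ x : Circle, ((x : ℂ)⁻¹) ^ n ∂(μ : Measure Circle)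
        - ∫ x : Circle, ((x : ℂ)⁻¹) ^ n ∂(ν : Measure Circle)
        = ε * (∫ x : Circle, ((x : ℂ)⁻¹) ^ (n + 1) * ((x : ℂ) / ((x : ℂ) - ε))
            ∂(ν : Measure Circle)
          - ∫ x : Circle, ((x : ℂ)⁻¹) ^ (n + 1) * ((x : ℂ) / ((x : ℂ) - ε))
            ∂(μ : Measure Circle)) := by
      linear_combination h1
    have h3 : d ≤ ε * 4 := by
      simp only [d]
      rw [h2, norm_mul, hnε]
      refine mul_le_mul_of_nonneg_left ((norm_sub_le _ _).trans ?_) hε.le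
      linarith [bound μ (n + 1) ε (hnε.trans_le hε2), bound ν (n + 1) ε (hnε.trans_le hε2)]
    linarith
  have transform : ∀ n : ℕ, ∀ z ∈ disc, z ≠ 0 →
      ∫ x : Circle, ((x : ℂ)⁻¹) ^ n * ((x : ℂ) / ((x : ℂ) - z)) ∂(μ : Measure Circle)
        = ∫ x : Circle, ((x : ℂ)⁻¹) ^ n * ((x : ℂ) / ((x : ℂ) - z)) ∂(ν : Measure Circle) := by
    intro n
    induction n with
    | zero =>
      intro z hz _
      simpa using integral_mul_inv_sub_eq h hz
    | succ n ih =>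
      intro z hz hz0
      have h1 := ih z hz hz0
      rw [step μ n z hz, step ν n z hz, moment n ih] at h1
      exact mul_left_cancel₀ hz0 (add_left_cancel h1)
  exact moment n (transform n)

theorem integral_zpow_eq (h : EqOn (herglotz μ) (herglotz ν) disc) (n : ℤ) :
    ∫ x : Circle, (x : ℂ) ^ n ∂(μ : Measure Circle)
      = ∫ x : Circle, (x : ℂ) ^ n ∂(ν : Measure Circle) := by
  have hneg : ∀ n : ℕ, ∫ x : Circle, ((x : ℂ)⁻¹) ^ n ∂(μ : Measure Circle)
      = ∫ x : Circle, ((x : ℂ)⁻¹) ^ n ∂(ν : Measure Circle) := integral_inv_pow_eq h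
  obtain ⟨k, rfl | rfl⟩ := n.eq_nat_or_neg
  · have h1 := congrArg (starRingEnd ℂ) (hneg k)
    rw [← integral_conj, ← integral_conj] at h1
    have h2 : ∀ x : Circle, (starRingEnd ℂ) (((x : ℂ)⁻¹) ^ k) = (x : ℂ) ^ (k : ℤ) := fun x => by
      rw [map_pow, ← Circle.coe_inv, Circle.coe_inv_eq_conj, Complex.conj_conj, zpow_natCast]
    simpa only [h2] using h1
  · simpa only [zpow_neg, zpow_natCast, inv_pow] using hneg k

/-- A probability measure on the circle is determined by its Herglotz function. -/
theorem herglotz_injective (h : EqOn (herglotz μ) (herglotz ν) disc) : μ = ν := by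
  let e : BoundedContinuousFunction Circle ℂ :=
    BoundedContinuousFunction.mkOfCompact ⟨_, continuous_circle_coe⟩
  -- Asking for all Fourier coefficients at once makes the property stable under multiplication by
  -- the coordinate and its conjugate, which only shift `n`. It thus passes to the star algebra they
  -- generate, which separates points.
  let I : BoundedContinuousFunction Circle ℂ → Prop := fun g => ∀ n : ℤ,
    ∫ x : Circle, (x : ℂ) ^ n * g x ∂(μ : Measure Circle)
      = ∫ x : Circle, (x : ℂ) ^ n * g x ∂(ν : Measure Circle)
  have hint : ∀ (ρ : ProbabilityMeasure Circle) (n : ℤ) (g : BoundedContinuousFunction Circle ℂ),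
      Integrable (fun x : Circle => (x : ℂ) ^ n * g x) (ρ : Measure Circle) := fun ρ n g =>
    integrable_of_continuous_circle
      ((continuous_circle_coe.zpow₀ n fun x => Or.inl x.coe_ne_zero).mul g.continuous)
  have hI1 : I 1 := fun n => by simpa using integral_zpow_eq h n
  have hadd : ∀ f g, I f → I g → I (f + g) := fun f g hf hg n => by
    simp only [BoundedContinuousFunction.add_apply, mul_add]
    rw [integral_add (hint μ n f) (hint μ n g), integral_add (hint ν n f) (hint ν n g), hf n, hg n]
  have hmem : ∀ g ∈ StarAlgebra.adjoin ℂ {e},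
      (∀ f, I f → I (g * f)) ∧ ∀ f, I f → I (star g * f) := by
    intro g hg
    refine StarAlgebra.adjoin_induction
      (p := fun g _ => (∀ f, I f → I (g * f)) ∧ ∀ f, I f → I (star g * f)) ?_ ?_ ?_ ?_ ?_ hg
    · rintro _ rfl
      refine ⟨fun f hf n => ?_, fun f hf n => ?_⟩
      · have h1 : ∀ x : Circle, (x : ℂ) ^ n * (e * f) x = (x : ℂ) ^ (n + 1) * f x := fun x => by
          rw [BoundedContinuousFunction.mul_apply, zpow_add_one₀ x.coe_ne_zero]
          exact (mul_assoc _ _ _).symm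
        simpa only [h1] using hf (n + 1)
      · have h1 : ∀ x : Circle, (x : ℂ) ^ n * (star e * f) x = (x : ℂ) ^ (n - 1) * f x :=
          fun x => by
          rw [BoundedContinuousFunction.mul_apply, zpow_sub_one₀ x.coe_ne_zero, ← Circle.coe_inv,
            Circle.coe_inv_eq_conj]
          exact (mul_assoc _ _ _).symm
        simpa only [h1] using hf (n - 1)
    · have hconst : ∀ (c : ℂ) (f : BoundedContinuousFunction Circle ℂ), I f → I (c • f) :=
        fun c f hf n => by
        simp only [BoundedContinuousFunction.coe_smul, smul_eq_mul, mul_left_comm _ c]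
        rw [integral_const_mul, integral_const_mul, hf n]
      intro c
      rw [← algebraMap_star_comm]
      exact ⟨fun f hf => by rw [← Algebra.smul_def]; exact hconst c f hf,
        fun f hf => by rw [← Algebra.smul_def]; exact hconst _ f hf⟩
    · rintro x y - - ⟨hx, hx'⟩ ⟨hy, hy'⟩
      rw [star_add]
      exact ⟨fun f hf => by rw [add_mul]; exact hadd _ _ (hx f hf) (hy f hf),
        fun f hf => by rw [add_mul]; exact hadd _ _ (hx' f hf) (hy' f hf)⟩
    · rintro x y - - ⟨hx, hx'⟩ ⟨hy, hy'⟩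
      rw [star_mul']
      exact ⟨fun f hf => by rw [mul_assoc]; exact hx _ (hy f hf),
        fun f hf => by rw [mul_assoc]; exact hx' _ (hy' f hf)⟩
    · rintro x - ⟨hx, hx'⟩
      rw [star_star]
      exact ⟨hx', hx⟩
  have := ext_of_forall_mem_subalgebra_integral_eq_of_pseudoEMetric_complete_countable
    (P := (μ : Measure Circle)) (P' := (ν : Measure Circle)) (A := StarAlgebra.adjoin ℂ {e})
    (fun x y hxy => ⟨e, ⟨⟨e.toContinuousMap, ⟨e, StarAlgebra.subset_adjoin ℂ _ rfl, rfl⟩, rfl⟩,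
      fun hc => hxy (Circle.ext hc)⟩⟩)
    (fun g hg => by simpa using (hmem g hg).1 1 hI1 0)
  exact Subtype.ext this

end Uniqueness

/-! ### A holomorphic family of contractions -/

section FixedPoint

/-- Holomorphic dependence on `w` of the solution of `z = w exp (-t Q z)`. -/
theorem exists_differentiableOn_fixedPoint {Q : ℂ → ℂ} {δ C t : ℝ}
    (hQ : DifferentiableOn ℂ Q disc) (ht : 0 ≤ t)
    (hδ : ∀ z ∈ Metric.closedBall (0 : ℂ) (1 / 2), δ ≤ (Q z).re)
    (hC : ∀ z ∈ Metric.closedBall (0 : ℂ) (1 / 2), ‖deriv Q z‖ ≤ C)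
    (h1 : 2 * Real.exp (-(t * δ)) ≤ 1 / 2) (h2 : 2 * (t * C * Real.exp (-(t * δ))) ≤ 1 / 2) :
    ∃ G : ℂ → ℂ, DifferentiableOn ℂ G (Metric.ball 0 2) ∧
      (∀ w ∈ Metric.ball (0 : ℂ) 2, ‖G w‖ ≤ 2 * Real.exp (-(t * δ))) ∧
      ∀ w ∈ Metric.ball (0 : ℂ) 2, ∀ z ∈ Metric.closedBall (0 : ℂ) (1 / 2),
        z = w * Complex.exp (-(t : ℂ) * Q z) → z = G w := by
  set K := Metric.closedBall (0 : ℂ) (1 / 2) with hK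
  have hKdisc : K ⊆ disc := Metric.closedBall_subset_ball (by norm_num)
  have hQd : ∀ z ∈ K, HasDerivAt Q (deriv Q z) z := fun z hz =>
    (hQ.differentiableAt (Metric.isOpen_ball.mem_nhds (hKdisc hz))).hasDerivAt
  have hC0 : 0 ≤ C := (norm_nonneg _).trans (hC 0 (by simp [hK]))
  set q := Real.exp (-(t * δ)) with hq
  have hq0 : 0 < q := Real.exp_pos _
  let E : ℂ → ℂ := fun z => Complex.exp (-(t : ℂ) * Q z)
  have hEle : ∀ z ∈ K, ‖E z‖ ≤ q := by
    intro z hz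
    rw [Complex.norm_exp, hq, Real.exp_le_exp]
    have : (-(t : ℂ) * Q z).re = -(t * (Q z).re) := by simp
    rw [this]
    exact neg_le_neg (mul_le_mul_of_nonneg_left (hδ z hz) ht)
  have hEd : ∀ z ∈ K, HasDerivAt E (E z * (-(t : ℂ) * deriv Q z)) z := fun z hz =>
    ((hQd z hz).const_mul _).cexp
  have hElip : ∀ x ∈ K, ∀ y ∈ K, ‖E y - E x‖ ≤ (t * C * q) * ‖y - x‖ := by
    intro x hx y hy
    refine (convex_closedBall (0 : ℂ) (1 / 2)).norm_image_sub_le_of_norm_hasDerivWithin_le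
      (𝕜 := ℂ) (fun z hz => (hEd z hz).hasDerivWithinAt) (fun z hz => ?_) hx hy
    rw [norm_mul, norm_mul, norm_neg, Complex.norm_real, Real.norm_of_nonneg ht, mul_comm]
    exact mul_le_mul (mul_le_mul_of_nonneg_left (hC z hz) ht) (hEle z hz) (norm_nonneg _)
      (by positivity)
  have hlip : ∀ w ∈ Metric.ball (0 : ℂ) 2, ∀ x ∈ K, ∀ y ∈ K,
      ‖w * E y - w * E x‖ ≤ 1 / 2 * ‖y - x‖ := by
    intro w hw x hx y hy
    have hw2 : ‖w‖ ≤ 2 := (mem_ball_zero_iff.1 hw).le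
    rw [← mul_sub, norm_mul]
    calc ‖w‖ * ‖E y - E x‖ ≤ 2 * ((t * C * q) * ‖y - x‖) :=
          mul_le_mul hw2 (hElip x hx y hy) (norm_nonneg _) zero_le_two
      _ = 2 * (t * C * q) * ‖y - x‖ := by ring
      _ ≤ 1 / 2 * ‖y - x‖ := mul_le_mul_of_nonneg_right h2 (norm_nonneg _)
  have hmul : ∀ w ∈ Metric.ball (0 : ℂ) 2, ∀ z ∈ K, ‖w * E z‖ ≤ 2 * q := by
    intro w hw z hz
    rw [norm_mul]
    exact mul_le_mul (mem_ball_zero_iff.1 hw).le (hEle z hz) (norm_nonneg _) zero_le_two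
  have hex : ∀ w ∈ Metric.ball (0 : ℂ) 2, ∃ z ∈ K, w * E z = z := by
    intro w hw
    have hmaps : MapsTo (fun z => w * E z) K K := fun z hz =>
      mem_closedBall_zero_iff.2 ((hmul w hw z hz).trans h1)
    have hLip : LipschitzOnWith (1 / 2) (fun z => w * E z) K :=
      LipschitzOnWith.of_dist_le_mul fun x hx y hy => by
        simpa [dist_eq_norm] using hlip w hw y hy x hx
    have hcontr : ContractingWith (1 / 2) (hmaps.restrict (fun z => w * E z) K K) :=
      ⟨by rw [← NNReal.coe_lt_coe]; norm_num, hLip.mapsToRestrict hmaps⟩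
    obtain ⟨z, hz, hfix, -⟩ := hcontr.exists_fixedPoint' (x := 0)
      Metric.isClosed_closedBall.isComplete hmaps (by simp [hK]) (edist_ne_top _ _)
    exact ⟨z, hz, hfix⟩
  choose! G hGK hG using hex
  have huniq : ∀ w ∈ Metric.ball (0 : ℂ) 2, ∀ z ∈ K, z = w * E z → z = G w := by
    intro w hw z hz h
    have h3 := hlip w hw (G w) (hGK w hw) z hz
    rw [← h, hG w hw] at h3
    have h4 : ‖z - G w‖ = 0 := le_antisymm (by linarith) (norm_nonneg _)
    exact sub_eq_zero.1 (norm_eq_zero.1 h4)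
  have hGle : ∀ w ∈ Metric.ball (0 : ℂ) 2, ‖G w‖ ≤ 2 * q := fun w hw => by
    rw [← hG w hw]
    exact hmul w hw _ (hGK w hw)
  -- The contraction constant `1/2` absorbs half of `‖G v - G w‖`, which explains the factor `2`.
  have hGlip : ∀ w ∈ Metric.ball (0 : ℂ) 2, ∀ v ∈ Metric.ball (0 : ℂ) 2,
      ‖G v - G w‖ ≤ 2 * ‖v - w‖ := by
    intro w hw v hv
    have h3 : G v - G w = (w * E (G v) - w * E (G w)) + (v - w) * E (G v) := by
      rw [hG w hw, sub_mul, hG v hv]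
      ring
    have h4 : ‖(v - w) * E (G v)‖ ≤ ‖v - w‖ := by
      rw [norm_mul]
      exact mul_le_of_le_one_right (norm_nonneg _) ((hEle _ (hGK v hv)).trans (by linarith))
    have h5 := norm_add_le (w * E (G v) - w * E (G w)) ((v - w) * E (G v))
    rw [← h3] at h5
    linarith [hlip w hw (G w) (hGK w hw) (G v) (hGK v hv)]
  refine ⟨G, fun w hw => ?_, hGle, huniq⟩
  have hnhds : Metric.ball (0 : ℂ) 2 ∈ 𝓝 w := Metric.isOpen_ball.mem_nhds hw
  have hcont : ContinuousAt G w := by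
    rw [ContinuousAt, tendsto_iff_norm_sub_tendsto_zero]
    have hlim : Tendsto (fun v => 2 * ‖v - w‖) (𝓝 w) (𝓝 0) := by
      have : Continuous fun v : ℂ => 2 * ‖v - w‖ := by fun_prop
      simpa using this.tendsto w
    refine squeeze_zero' (Eventually.of_forall fun v => norm_nonneg _) ?_ hlim
    filter_upwards [hnhds] with v hv using hGlip w hw v hv
  -- `G` is a continuous right inverse of `z ↦ z * exp (t * Q z)`, whose derivative at `G w` is a
  -- nonzero exponential times `1 + G w * t * Q'`, with second summand of norm at most `1/2`.
  have hinv : HasDerivAt (fun z => z * Complex.exp ((t : ℂ) * Q z))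
      (1 * Complex.exp ((t : ℂ) * Q (G w))
        + G w * (Complex.exp ((t : ℂ) * Q (G w)) * ((t : ℂ) * deriv Q (G w)))) (G w) :=
    (hasDerivAt_id (G w)).mul ((hQd _ (hGK w hw)).const_mul (t : ℂ)).cexp
  have hne : 1 * Complex.exp ((t : ℂ) * Q (G w))
      + G w * (Complex.exp ((t : ℂ) * Q (G w)) * ((t : ℂ) * deriv Q (G w))) ≠ 0 := by
    have h3 : ‖G w * ((t : ℂ) * deriv Q (G w))‖ ≤ 1 / 2 := by
      rw [norm_mul, norm_mul, Complex.norm_real, Real.norm_of_nonneg ht]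
      calc ‖G w‖ * (t * ‖deriv Q (G w)‖) ≤ 2 * q * (t * C) :=
            mul_le_mul (hGle w hw) (mul_le_mul_of_nonneg_left (hC _ (hGK w hw)) ht)
              (by positivity) (by positivity)
        _ = 2 * (t * C * q) := by ring
        _ ≤ 1 / 2 := h2
    have h4 : 1 + G w * ((t : ℂ) * deriv Q (G w)) ≠ 0 := by
      intro h0
      rw [eq_neg_of_add_eq_zero_right h0, norm_neg, norm_one] at h3
      norm_num at h3
    have h5 : 1 * Complex.exp ((t : ℂ) * Q (G w))
        + G w * (Complex.exp ((t : ℂ) * Q (G w)) * ((t : ℂ) * deriv Q (G w)))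
        = Complex.exp ((t : ℂ) * Q (G w)) * (1 + G w * ((t : ℂ) * deriv Q (G w))) := by ring
    rw [h5]
    exact mul_ne_zero (Complex.exp_ne_zero _) h4
  refine (HasDerivAt.of_local_left_inverse hcont hinv hne ?_).differentiableAt.differentiableWithinAt
  filter_upwards [hnhds] with v hv
  have h3 := hG v hv
  have h4 : E (G v) * Complex.exp ((t : ℂ) * Q (G v)) = 1 := by
    simp only [E]
    rw [← Complex.exp_add]
    simp
  calc G v * Complex.exp ((t : ℂ) * Q (G v))
      = v * (E (G v) * Complex.exp ((t : ℂ) * Q (G v))) := by rw [← mul_assoc, h3]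
    _ = v := by rw [h4, mul_one]

end FixedPoint

/-! ### Extension of the solution beyond the disc for large times -/

namespace IsSolution

variable {S : ℂ → ℂ} {α : ProbabilityMeasure Circle} {M : ℝ → ℂ → ℂ}

/-- For large times a solution extends to the disc of radius `2`, with values in the right
half-plane, and the extensions converge uniformly to `1`. -/
theorem exists_extension (hM : IsSolution S α M) (hS : DifferentiableOn ℂ S rightHalfPlane)
    (hS_maps : MapsTo S rightHalfPlane rightHalfPlane) :
    ∃ (T : ℝ) (F : ℝ → ℂ → ℂ), 0 < T ∧
      (∀ t, T ≤ t → DifferentiableOn ℂ (F t) (Metric.ball 0 2) ∧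
        MapsTo (F t) (Metric.ball 0 2) rightHalfPlane ∧ EqOn (F t) (M t) disc) ∧
      TendstoUniformlyOn F (fun _ => 1) atTop (Metric.ball 0 2) := by
  let Q : ℂ → ℂ := fun z => S (M 0 z)
  have hM0 := hM.differentiableOn 0 le_rfl
  have hQ : DifferentiableOn ℂ Q disc := hS.comp hM0 (hM.mapsTo 0 le_rfl)
  have hKdisc : Metric.closedBall (0 : ℂ) (1 / 2) ⊆ disc :=
    Metric.closedBall_subset_ball (by norm_num)
  obtain ⟨δ, hδ0, hδ⟩ : ∃ δ : ℝ, 0 < δ ∧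
      ∀ z ∈ Metric.closedBall (0 : ℂ) (1 / 2), δ ≤ (Q z).re := by
    obtain ⟨z₀, hz₀, hmin⟩ := (isCompact_closedBall (0 : ℂ) (1 / 2)).exists_isMinOn
      ⟨0, by simp⟩ (Complex.continuous_re.comp_continuousOn (hQ.continuousOn.mono hKdisc))
    exact ⟨(Q z₀).re, hS_maps (hM.mapsTo 0 le_rfl (hKdisc hz₀)), fun z hz => hmin hz⟩
  obtain ⟨C, hC⟩ : ∃ C : ℝ, ∀ z ∈ Metric.closedBall (0 : ℂ) (1 / 2), ‖deriv Q z‖ ≤ C :=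
    (isCompact_closedBall _ _).exists_bound_of_continuousOn
      ((hQ.deriv Metric.isOpen_ball).continuousOn.mono hKdisc)
  have hlim0 : Tendsto (fun t : ℝ => 2 * Real.exp (-(t * δ))) atTop (𝓝 0) := by
    have h := (Real.tendsto_exp_neg_atTop_nhds_zero.comp
      (tendsto_id.atTop_mul_const hδ0)).const_mul 2
    simpa using h
  have hlim1 : Tendsto (fun t : ℝ => 2 * (t * C * Real.exp (-(t * δ)))) atTop (𝓝 0) := by
    have h := (tendsto_rpow_mul_exp_neg_mul_atTop_nhds_zero 1 δ hδ0).const_mul (2 * C)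
    rw [mul_zero] at h
    refine h.congr fun t => ?_
    rw [Real.rpow_one, neg_mul, mul_comm δ t]
    ring
  obtain ⟨T₀, hT₀⟩ := eventually_atTop.1
    ((hlim0.eventually (ge_mem_nhds (show (0 : ℝ) < 1 / 2 by norm_num))).and
      (hlim1.eventually (ge_mem_nhds (show (0 : ℝ) < 1 / 2 by norm_num))))
  -- The maximum with `1` guarantees a positive threshold.
  have hex : ∀ t, max T₀ 1 ≤ t → ∃ G : ℂ → ℂ, DifferentiableOn ℂ G (Metric.ball 0 2) ∧
      (∀ w ∈ Metric.ball (0 : ℂ) 2, ‖G w‖ ≤ 2 * Real.exp (-(t * δ))) ∧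
      ∀ w ∈ Metric.ball (0 : ℂ) 2, ∀ z ∈ Metric.closedBall (0 : ℂ) (1 / 2),
        z = w * Complex.exp (-(t : ℂ) * Q z) → z = G w := by
    intro t ht
    have h := hT₀ t ((le_max_left _ _).trans ht)
    exact exists_differentiableOn_fixedPoint hQ
      (zero_le_one.trans ((le_max_right _ _).trans ht)) hδ hC h.1 h.2
  choose! G hGd hGle hGu using hex
  have hmem : ∀ t, max T₀ 1 ≤ t → MapsTo (G t) (Metric.ball 0 2) disc := fun t ht w hw =>
    hKdisc (mem_closedBall_zero_iff.2 ((hGle t ht w hw).trans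
      (hT₀ t ((le_max_left _ _).trans ht)).1))
  refine ⟨max T₀ 1, fun t w => M 0 (G t w), zero_lt_one.trans_le (le_max_right _ _),
    fun t ht => ⟨hM0.comp (hGd t ht) (hmem t ht),
      fun w hw => hM.mapsTo 0 le_rfl (hmem t ht hw), ?_⟩, ?_⟩
  · have ht0 : 0 ≤ t := zero_le_one.trans ((le_max_right _ _).trans ht)
    have hsub : disc ⊆ Metric.ball (0 : ℂ) 2 := Metric.ball_subset_ball one_le_two
    have han : AnalyticOnNhd ℂ (fun w => M 0 (G t w)) disc :=
      ((hM0.comp (hGd t ht) (hmem t ht)).mono hsub).analyticOnNhd Metric.isOpen_ball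
    have han' : AnalyticOnNhd ℂ (M t) disc :=
      (hM.differentiableOn t ht0).analyticOnNhd Metric.isOpen_ball
    refine han.eqOn_of_preconnected_of_eventuallyEq han' (convex_ball 0 1).isPreconnected
      zero_mem_disc ?_
    -- By the identity theorem, agreement near `0` suffices. For `‖w‖ ≤ 1/2` the point `g t w` lies
    -- in the ball where the fixed point is unique, and it solves the fixed-point equation because
    -- `M 0 (g t w) = M t w`.
    filter_upwards [Metric.closedBall_mem_nhds (0 : ℂ) (show (0 : ℝ) < 1 / 2 by norm_num)]
      with w hw
    have hwd := hKdisc hw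
    have hg := hM.apply_zero_loewnerChain hS hS_maps ht0 hwd
    have hgw : loewnerChain S M t w = G t w := by
      refine hGu t ht w (hsub hwd) _ ?_ ?_
      · rw [mem_closedBall_zero_iff] at hw ⊢
        exact (norm_mul_exp_neg_le ht0 (show 0 < (S (M t w)).re from
          hS_maps (hM.mapsTo t ht0 hwd)).le).trans hw
      · simp only [Q]
        rw [hg]
        rfl
    rw [← hgw, hg]
  · rw [Metric.tendstoUniformlyOn_iff]
    intro ε hε
    have hc : ContinuousAt (M 0) 0 :=
      hM0.continuousOn.continuousAt (Metric.isOpen_ball.mem_nhds zero_mem_disc)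
    obtain ⟨η, hη, hηε⟩ := Metric.continuousAt_iff.1 hc ε hε
    filter_upwards [hlim0.eventually (gt_mem_nhds hη), eventually_ge_atTop (max T₀ 1)]
      with t ht htT w hw
    have := hηε (x := G t w) (by
      rw [dist_zero_right]
      exact (hGle t htT w hw).trans_lt ht)
    rwa [hM.apply_zero le_rfl, dist_comm] at this

end IsSolution

/-! ### Weak convergence from uniform convergence of densities -/

section WeakConvergence

/-- If the densities `Re F_t` converge uniformly on the circle to `1`, the measures converge
weakly to the uniform distribution. -/
theorem tendsto_uniformDistribution {ι : Type*} {l : Filter ι} {F : ι → ℂ → ℂ}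
    {ν : ι → ProbabilityMeasure Circle}
    (hν : ∀ᶠ i in l, DiffContOnCl ℂ (F i) disc ∧ (∀ x : Circle, 0 ≤ (F i x).re) ∧
      (ν i : Measure Circle) = densityMeasure (F i))
    (hF : ∀ ε > 0, ∀ᶠ i in l, ∀ x : Circle, ‖F i x - 1‖ ≤ ε) :
    Tendsto ν l (𝓝 uniformDistribution) := by
  rw [ProbabilityMeasure.tendsto_iff_forall_integral_tendsto]
  intro f
  rw [tendsto_iff_norm_sub_tendsto_zero, Metric.tendsto_nhds]
  intro ε hε
  have hpos : 0 < ‖f‖ + 1 := by positivity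
  filter_upwards [hν, hF (ε / (2 * (‖f‖ + 1))) (by positivity)] with i ⟨hd, hre, hi⟩ hb
  have hcont := Complex.continuous_re.comp (continuous_circle_of_diffContOnCl hd)
  have h1 : ∫ x, f x ∂(ν i : Measure Circle) - ∫ x, f x ∂(uniformDistribution : Measure Circle)
      = ∫ x : Circle, ((F i x).re - 1) * f x ∂uniformMeasure := by
    rw [hi, integral_densityMeasure hd hre]
    change _ - ∫ x, f x ∂uniformMeasure = _
    have hint : Integrable (fun x : Circle => (F i x).re • f x) uniformMeasure :=
      integrable_of_continuous_circle (hcont.smul f.continuous)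
    rw [← integral_sub hint (integrable_of_continuous_circle f.continuous)]
    congr 1
    ext x
    simp only [smul_eq_mul]
    ring
  have h2 : ‖∫ x : Circle, ((F i x).re - 1) * f x ∂uniformMeasure‖ ≤ ε / 2 := by
    refine (norm_integral_le_of_norm_le_const (C := ε / 2)
      (Eventually.of_forall fun x => ?_)).trans (by simp)
    have h3 : ‖(F i x).re - 1‖ ≤ ε / (2 * (‖f‖ + 1)) := by
      refine le_trans ?_ (hb x)
      simpa using Complex.abs_re_le_norm (F i x - 1)
    rw [norm_mul]
    calc ‖(F i x).re - 1‖ * ‖f x‖ ≤ ε / (2 * (‖f‖ + 1)) * (‖f‖ + 1) :=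
          mul_le_mul h3 ((f.norm_coe_le_norm x).trans (by linarith)) (norm_nonneg _) (by positivity)
      _ = ε / 2 := by field_simp
  rw [h1, dist_zero_right, norm_norm]
  linarith

end WeakConvergence

end BurgersLoewner

end

/-! ### Assembly of the main theorem -/

theorem theorem4p4 (S : ℂ → ℂ)
    (hS : DifferentiableOn ℂ S BurgersLoewner.rightHalfPlane)
    (hS_maps : MapsTo S BurgersLoewner.rightHalfPlane BurgersLoewner.rightHalfPlane)
    (α : ProbabilityMeasure Circle) (M : ℝ → ℂ → ℂ)
    (hM : BurgersLoewner.IsSolution S α M) :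
    BurgersLoewner.IsDecreasingSubordinationChain M ∧
    ∃ μ : ℝ → ProbabilityMeasure Circle,
      (∀ t, 0 ≤ t → ∀ ν : ProbabilityMeasure Circle,
        EqOn (M t) (BurgersLoewner.herglotz ν) BurgersLoewner.disc ↔ ν = μ t) ∧
      (∃ T : ℝ, 0 < T ∧ ∀ t, T ≤ t →
        (μ t : Measure Circle).support = univ ∧
        (∃ F : ℂ → ℂ, AnalyticOnNhd ℂ F (Metric.closedBall 0 1) ∧
          EqOn F (M t) BurgersLoewner.disc ∧ ∀ x : Circle, 0 < (F x).re) ∧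
        (μ t : Measure Circle) ≪ BurgersLoewner.uniformDistribution) ∧
      TendstoLocallyUniformlyOn M (fun _ => 1) atTop BurgersLoewner.disc ∧
      Tendsto μ atTop (𝓝 BurgersLoewner.uniformDistribution) := by
  refine ⟨hM.isDecreasingSubordinationChain hS hS_maps, ?_⟩
  have hex : ∀ t, 0 ≤ t → ∃ μ : ProbabilityMeasure Circle,
      EqOn (M t) (BurgersLoewner.herglotz μ) BurgersLoewner.disc := fun t ht =>
    BurgersLoewner.exists_herglotz (hM.differentiableOn t ht) (hM.mapsTo t ht) (hM.apply_zero ht)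
  have : Nonempty (ProbabilityMeasure Circle) := ⟨α⟩
  choose! μ hμ using hex
  have hiff : ∀ t, 0 ≤ t → ∀ ν : ProbabilityMeasure Circle,
      EqOn (M t) (BurgersLoewner.herglotz ν) BurgersLoewner.disc ↔ ν = μ t := fun t ht ν =>
    ⟨fun h => BurgersLoewner.herglotz_injective (h.symm.trans (hμ t ht)), fun h => h ▸ hμ t ht⟩
  obtain ⟨T, F, hT, hF, hlim⟩ := hM.exists_extension hS hS_maps
  have hsub : Metric.closedBall (0 : ℂ) 1 ⊆ Metric.ball 0 2 :=
    Metric.closedBall_subset_ball one_lt_two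
  have hcircle : ∀ x : Circle, (x : ℂ) ∈ Metric.ball (0 : ℂ) 2 := fun x =>
    hsub (mem_closedBall_zero_iff.2 (BurgersLoewner.norm_circle_coe_le x))
  have hd : ∀ t, T ≤ t → DiffContOnCl ℂ (F t) BurgersLoewner.disc := fun t ht => by
    apply DifferentiableOn.diffContOnCl
    rw [closure_ball (0 : ℂ) one_ne_zero]
    exact (hF t ht).1.mono hsub
  have hre : ∀ t, T ≤ t → ∀ x : Circle, 0 < (F t x).re := fun t ht x =>
    (hF t ht).2.1 (hcircle x)
  have hdens : ∀ t, T ≤ t → (μ t : Measure Circle) = BurgersLoewner.densityMeasure (F t) := by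
    intro t ht
    have ht0 : 0 ≤ t := hT.le.trans ht
    have h0 : F t 0 = 1 := by
      rw [(hF t ht).2.2 BurgersLoewner.IsSolution.zero_mem_disc, hM.apply_zero ht0]
    have := BurgersLoewner.herglotz_densityProbabilityMeasure (hd t ht)
      (fun x => (hre t ht x).le) h0
    -- The density measure of the extension represents `M t` too, so uniqueness identifies it with
    -- `μ t`.
    rw [← (hiff t ht0 _).1 ((hF t ht).2.2.symm.trans this)]
    rfl
  refine ⟨μ, hiff, ⟨T, hT, fun t ht => ⟨?_, ⟨F t, ?_, (hF t ht).2.2, hre t ht⟩, ?_⟩⟩, ?_, ?_⟩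
  · rw [hdens t ht]
    exact BurgersLoewner.support_densityMeasure (hd t ht) (hre t ht)
  · exact ((hF t ht).1.analyticOnNhd Metric.isOpen_ball).mono hsub
  · rw [hdens t ht]
    exact BurgersLoewner.densityMeasure_absolutelyContinuous
  · refine TendstoUniformlyOn.tendstoLocallyUniformlyOn ?_
    refine (hlim.mono (Metric.ball_subset_ball one_le_two)).congr ?_
    filter_upwards [eventually_ge_atTop T] with t ht using (hF t ht).2.2
  · refine BurgersLoewner.tendsto_uniformDistribution (F := F) ?_ fun ε hε => ?_
    · filter_upwards [eventually_ge_atTop T] with t ht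
      exact ⟨hd t ht, fun x => (hre t ht x).le, hdens t ht⟩
    · filter_upwards [Metric.tendstoUniformlyOn_iff.1 hlim ε hε] with t ht x
      rw [← dist_eq_norm, dist_comm]
      exact (ht x (hcircle x)).le
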